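/- Let $\mathbb{N}=\{1,2,3,\dots\}$. For $\alpha>0$ and $0<\gamma<1$ put $g_{\alpha,\gamma}(n)=\lfloor\alpha n+\gamma\rfloor$ for $n\in\mathbb{N}$, and for $A\subseteq\mathbb{N}$ let $g_{\alpha,\gamma}[A]=\{g_{\alpha,\gamma}(n):n\in A\}\cap\mathbb{N}$ (the value $0$, which can occur for finitely many $n$ when $\alpha<1$, is discarded). A family on $\mathbb{N}$ is a nonempty collection $\mathcal{F}$ of nonempty subsets of $\mathbb{N}$ such that $A\in\mathcal{F}$ and $A\subseteq B\subseteq\mathbb{N}$ imply $B\in\mathcal{F}$. It has the Ramsey property if $A_1\cup A_2\in\mathcal{F}$ implies $A_1\in\mathcal{F}$ or $A_2\in\mathcal{F}$; it is shift invariant if $s+E\in\mathcal{F}$, and inverse shift invariant if $-s+E=\{t\in\mathbb{N}:s+t\in E\}\in\mathcal{F}$, for all $s\in\mathbb{N}$ and $E\in\mathcal{F}$. Its dual is $\mathcal{F}^{\star}=\{E\subseteq\mathbb{N}:E\cap A\neq\emptyset\text{ for all }A\in\mathcal{F}\}$. Let $\mathcal{F}$ be a shift invariant and inverse shift invariant family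 on $\mathbb{N}$ with the Ramsey property such that $g_{\alpha',\gamma'}[A]\in\mathcal{F}$ for all $A\in\mathcal{F}$, all $\alpha'>0$ and all $0<\gamma'<1$. Then for all $0<\alpha\le 1$ and $0<\gamma<1$ one has $g_{\alpha,\gamma}[\mathcal{F}^{\star}]\subseteq\mathcal{F}^{\star}$, that is, $g_{\alpha,\gamma}[A]\in\mathcal{F}^{\star}$ for every $A\in\mathcal{F}^{\star}$. -/

import Mathlib

/-- A family on `S`: a nonempty, upward hereditary collection of nonempty subsets of `S`. -/
structure IsSetFamily {S : Type*} (F : Set (Set S)) : Prop where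
  nonempty : F.Nonempty
  empty_notMem : ∅ ∉ F
  upward : ∀ ⦃A B : Set S⦄, A ∈ F → A ⊆ B → B ∈ F

/-- The dual family `F*`: all subsets of `S` that meet every member of `F`. -/
def dualSetFamily {S : Type*} (F : Set (Set S)) : Set (Set S) :=
  {E | ∀ A ∈ F, (E ∩ A).Nonempty}

/-- The Ramsey property: if a member of `F` is split into two pieces, one of the pieces is
a member of `F`. -/
def HasRamseyProperty {S : Type*} (F : Set (Set S)) : Prop :=
  ∀ A₁ A₂ : Set S, A₁ ∪ A₂ ∈ F → A₁ ∈ F ∨ A₂ ∈ F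

/-- Shift invariance: `s + E ∈ F` for all `s ∈ S` and `E ∈ F`. -/
def ShiftInvariant {S : Type*} [Add S] (F : Set (Set S)) : Prop :=
  ∀ s : S, ∀ E ∈ F, (fun t => s + t) '' E ∈ F

/-- Inverse shift invariance: `-s + E = {t | s + t ∈ E} ∈ F` for all `s ∈ S` and `E ∈ F`. -/
def InverseShiftInvariant {S : Type*} [Add S] (F : Set (Set S)) : Prop :=
  ∀ s : S, ∀ E ∈ F, {t | s + t ∈ E} ∈ F

/-- The nonhomogeneous spectrum map `g_{α,γ}(n) = ⌊α n + γ⌋` on the positive integers.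
The value `0` is possible for finitely many `n` when `α < 1`. -/
noncomputable def spectrumMap (α γ : ℝ) (n : ℕ+) : ℤ := ⌊α * (n : ℝ) + γ⌋

/-- `g_{α,γ}[A]`, as a set of positive integers. -/
def spectrumImage (α γ : ℝ) (A : Set ℕ+) : Set ℕ+ :=
  {m | ∃ n ∈ A, spectrumMap α γ n = (m : ℤ)}

/-! By duality it suffices that preimages under `g_{α,γ}` of members of `F` lie in `F`. For `α < 1`
such a preimage contains an integer translate of `g_{1/α,δ}[A]`, which is in `F`; for `α = 1` the
map is the identity. -/

/-- A shift invariant and inverse shift invariant family is invariant under translation by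
integers, where the non-positive values are discarded. -/
theorem int_translate_mem {F : Set (Set ℕ+)} (hF : IsSetFamily F) (hshift : ShiftInvariant F)
    (hinv : InverseShiftInvariant F) (k : ℤ) {E : Set ℕ+} (hE : E ∈ F) :
    {t : ℕ+ | ∃ e ∈ E, (t : ℤ) = (e : ℤ) + k} ∈ F := by
  rcases lt_trichotomy k 0 with hk | rfl | hk
  · obtain ⟨s, hs⟩ : ∃ s : ℕ+, (s : ℤ) = -k :=
      ⟨⟨k.natAbs, by omega⟩, by rw [PNat.mk_coe]; omega⟩
    refine hF.upward (hinv s E hE) fun t ht => ⟨s + t, ht, ?_⟩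
    push_cast
    omega
  · exact hF.upward hE fun t ht => ⟨t, ht, by simp⟩
  · obtain ⟨s, hs⟩ : ∃ s : ℕ+, (s : ℤ) = k :=
      ⟨⟨k.natAbs, by omega⟩, by rw [PNat.mk_coe]; omega⟩
    refine hF.upward (hshift s E hE) ?_
    rintro _ ⟨e, he, rfl⟩
    refine ⟨e, he, ?_⟩
    push_cast
    omega

/-- For `α < 1`, the map `g_{α,γ}` has a section of the form `m ↦ g_{1/α,δ}(m) + k`. -/
theorem exists_spectrumMap_section {α γ : ℝ} (hα0 : 0 < α) (hα1 : α < 1) :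
    ∃ δ : ℝ, ∃ k : ℤ, 0 < δ ∧ δ < 1 ∧ ∀ m n : ℕ+,
      (n : ℤ) = spectrumMap α⁻¹ δ m + k → spectrumMap α γ n = (m : ℤ) := by
  -- If `n = ⌊m/α + x⌋`, then `m + αx - α < αn ≤ m + αx`, so `x` between these bounds forces `⌊αn +
  -- γ⌋ = m`. The gap is `1/α - 1`.
  have hlt : 1 - γ / α < (1 - γ) / α := by
    rw [sub_div]
    linarith [(one_lt_div hα0).2 hα1]
  -- Irrationality keeps `δ = Int.fract x` away from `0`.
  obtain ⟨x, hx, hx1, hx2⟩ := exists_irrational_btwn hlt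
  refine ⟨Int.fract x, ⌊x⌋, ?_, Int.fract_lt_one x, fun m n h => ?_⟩
  · exact (Int.fract_nonneg x).lt_of_ne fun h => hx.ne_int ⌊x⌋ (by
      have := Int.floor_add_fract x
      linarith)
  · have hn : ⌊α⁻¹ * (m : ℝ) + x⌋ = (n : ℤ) := by
      rw [h, spectrumMap, ← Int.floor_add_intCast, add_assoc, Int.fract_add_floor]
    rw [Int.floor_eq_iff] at hn
    obtain ⟨h1, h2⟩ := hn
    rw [spectrumMap, Int.floor_eq_iff]
    push_cast at h1 h2 ⊢
    have e1 : α * (1 - γ / α) = α - γ := by field_simp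
    have e2 : α * ((1 - γ) / α) = 1 - γ := by field_simp
    have e3 : α * (α⁻¹ * (m : ℝ) + x) = m + α * x := by field_simp
    have i1 := mul_lt_mul_of_pos_left hx1 hα0
    have i2 := mul_lt_mul_of_pos_left hx2 hα0
    have i3 := mul_le_mul_of_nonneg_left h1 hα0.le
    have i4 := mul_lt_mul_of_pos_left h2 hα0
    constructor <;> linarith

theorem spectrumMap_one {γ : ℝ} (hγ0 : 0 < γ) (hγ1 : γ < 1) (n : ℕ+) :
    spectrumMap 1 γ n = (n : ℤ) := by
  rw [spectrumMap, Int.floor_eq_iff]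
  push_cast
  constructor <;> linarith

/-- Preimages of members of `F` under `g_{α,γ}` belong to `F` when `α ≤ 1`. -/
theorem spectrumMap_preimage_mem {F : Set (Set ℕ+)} (hF : IsSetFamily F)
    (hshift : ShiftInvariant F) (hinv : InverseShiftInvariant F)
    (hg : ∀ α γ : ℝ, 0 < α → 0 < γ → γ < 1 → spectrumImage α γ '' F ⊆ F)
    {α γ : ℝ} (hα0 : 0 < α) (hα1 : α ≤ 1) (hγ0 : 0 < γ) (hγ1 : γ < 1)
    {A : Set ℕ+} (hA : A ∈ F) :
    {n : ℕ+ | ∃ m ∈ A, spectrumMap α γ n = (m : ℤ)} ∈ F := by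
  rcases hα1.eq_or_lt with rfl | hlt
  · exact hF.upward hA fun n hn => ⟨n, hn, spectrumMap_one hγ0 hγ1 n⟩
  · obtain ⟨δ, k, hδ0, hδ1, hsec⟩ := exists_spectrumMap_section (γ := γ) hα0 hlt
    have hB := hg α⁻¹ δ (inv_pos.2 hα0) hδ0 hδ1 ⟨A, hA, rfl⟩
    refine hF.upward (int_translate_mem hF hshift hinv k hB) ?_
    rintro n ⟨e, ⟨m, hm, he⟩, hn⟩
    exact ⟨m, hm, hsec m n (by rw [hn, he])⟩

theorem mainTheorem8 (F : Set (Set ℕ+)) (hF : IsSetFamily F) (hRamsey : HasRamseyProperty F)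
    (hshift : ShiftInvariant F) (hinv : InverseShiftInvariant F)
    (hg : ∀ α γ : ℝ, 0 < α → 0 < γ → γ < 1 → spectrumImage α γ '' F ⊆ F)
    (α γ : ℝ) (hα0 : 0 < α) (hα1 : α ≤ 1) (hγ0 : 0 < γ) (hγ1 : γ < 1) :
    spectrumImage α γ '' dualSetFamily F ⊆ dualSetFamily F := by
  rintro _ ⟨E, hE, rfl⟩ A hA
  obtain ⟨n, hnE, m, hmA, hnm⟩ :=
    hE _ (spectrumMap_preimage_mem hF hshift hinv hg hα0 hα1 hγ0 hγ1 hA)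
  exact ⟨m, ⟨n, hnE, hnm⟩, hmA⟩
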